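/- Let $X$ be the homogeneous tree of degree $q+1$ with $q\ge 2$, let $o\in X$ be a fixed vertex, and write $|x|=d(o,x)$ for the graph distance. Let $$\Delta f(x)=f(x)-\frac1{q+1}\sum_{y\sim x}f(y)$$ be the nearest-neighbour Laplacian on $\ell^2(X)$ and let $h_u(x)=(e^{-u\Delta}\delta_o)(x)$, $u>0$, be its heat kernel. Fix $\alpha\in(0,2)$, and for $t>0$ let $\eta_t$ be the (continuous) function on $(0,\infty)$ determined by its Laplace transform $$\int_0^\infty e^{-\lambda u}\eta_t(u)\,du=e^{-t\lambda^{\alpha/2}},\qquad \lambda>0,$$ that is, the density of the $\alpha/2$-stable subordinator. Let $$p_t(x)=\int_0^\infty h_u(x)\,\eta_t(u)\,du$$ be the $\alpha$-stable kernel. Then for all $0<\tilde A_1<\tilde A_2$ and every $\beta>0$ with $\beta\neq 2/\alpha$, $$\sum_{x\in X:\ \tilde A_1t^\beta\le |x|\le \tilde A_2t^\beta}p_t(x)\longrightarrow 0,\qquad t\to\infty .$$ -/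

import Mathlib

namespace HomogeneousTree

noncomputable section

open MeasureTheory Filter Topology Set
open scoped FourierTransform

lemma sum_avg_sq_le {V : Type*} (G : SimpleGraph V) [G.LocallyFinite] (q : ℕ)
    (hG : G.IsRegularOfDegree (q + 1)) (f : lp (fun _ : V => ℝ) 2) (s : Finset V) :
    ∑ x ∈ s, ‖((q : ℝ) + 1)⁻¹ * ∑ y ∈ G.neighborFinset x, f y‖ ^ (2 : ENNReal).toReal
      ≤ ‖f‖ ^ (2 : ENNReal).toReal := by
  classical
  have hq : (0 : ℝ) < (q : ℝ) + 1 := by positivity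
  have hcard : ∀ x, (((G.neighborFinset x).card : ℕ) : ℝ) = (q : ℝ) + 1 := fun x => by
    rw [G.card_neighborFinset_eq_degree, hG x]; push_cast; rfl
  have h1 : ∀ x, ‖((q : ℝ) + 1)⁻¹ * ∑ y ∈ G.neighborFinset x, f y‖ ^ (2 : ENNReal).toReal
      ≤ ((q : ℝ) + 1)⁻¹ * ∑ y ∈ G.neighborFinset x, (f y) ^ 2 := fun x => by
    have := sq_sum_le_card_mul_sum_sq (s := G.neighborFinset x) (f := fun y => f y)
    rw [hcard] at this
    rw [ENNReal.toReal_ofNat, Real.rpow_ofNat, Real.norm_eq_abs, sq_abs, mul_pow]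
    calc _ ≤ (((q : ℝ) + 1)⁻¹) ^ 2 * (((q : ℝ) + 1) * ∑ y ∈ G.neighborFinset x, (f y) ^ 2) := by
            gcongr
      _ = _ := by field_simp
  let T := s.biUnion fun x => G.neighborFinset x
  calc _ ≤ ∑ x ∈ s, ((q : ℝ) + 1)⁻¹ * ∑ y ∈ G.neighborFinset x, (f y) ^ 2 :=
        Finset.sum_le_sum fun x _ => h1 x
    _ = ((q : ℝ) + 1)⁻¹ * ∑ x ∈ s, ∑ y ∈ G.neighborFinset x, (f y) ^ 2 := by
        rw [Finset.mul_sum]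
    _ = ((q : ℝ) + 1)⁻¹ * ∑ y ∈ T, ∑ x ∈ s with G.Adj y x, (f y) ^ 2 := by
        congr 1
        apply Finset.sum_comm'
        intro x y
        simp only [SimpleGraph.mem_neighborFinset, Finset.mem_filter, Finset.mem_biUnion, T]
        constructor
        · rintro ⟨h, h'⟩; exact ⟨⟨h, h'.symm⟩, x, h, h'⟩
        · rintro ⟨⟨h, h'⟩, _⟩; exact ⟨h, h'.symm⟩
    _ ≤ ((q : ℝ) + 1)⁻¹ * ∑ y ∈ T, ((q : ℝ) + 1) * (f y) ^ 2 := by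
        gcongr with y hy
        rw [Finset.sum_const, nsmul_eq_mul, ← hcard y]
        gcongr
        intro x hx
        simpa using (Finset.mem_filter.1 hx).2
    _ = ∑ y ∈ T, ‖f y‖ ^ (2 : ENNReal).toReal := by
        rw [← Finset.mul_sum, inv_mul_cancel_left₀ hq.ne']
        simp
    _ ≤ _ := lp.sum_rpow_le_norm_rpow (by simp) f T

/-- The averaging operator `(A f)(x) = (q + 1)⁻¹ ∑_{y ∼ x} f(y)` on `ℓ²(V)`, for a graph which is
regular of degree `q + 1`. -/
def avgOp {V : Type*} (G : SimpleGraph V) [G.LocallyFinite] (q : ℕ)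
    (hG : G.IsRegularOfDegree (q + 1)) :
    lp (fun _ : V => ℝ) 2 →L[ℝ] lp (fun _ : V => ℝ) 2 :=
  LinearMap.mkContinuous
    { toFun := fun f =>
        ⟨fun x => ((q : ℝ) + 1)⁻¹ * ∑ y ∈ G.neighborFinset x, f y,
          memℓp_gen' (sum_avg_sq_le G q hG f)⟩
      map_add' := fun f g => by
        ext x
        exact (congrArg _ Finset.sum_add_distrib).trans (mul_add _ _ _)
      map_smul' := fun c f => by
        ext x
        simp [← Finset.mul_sum, mul_left_comm] }
    1 fun f => by
      rw [one_mul]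
      exact lp.norm_le_of_forall_sum_le (by simp) (norm_nonneg _) (sum_avg_sq_le G q hG f)

/-- The nearest-neighbour Laplacian `Δ f(x) = f(x) - (q + 1)⁻¹ ∑_{y ∼ x} f(y)`, as a bounded operator
on `ℓ²(V)`; see `laplacian_apply`. -/
def laplacian {V : Type*} (G : SimpleGraph V) [G.LocallyFinite] (q : ℕ)
    (hG : G.IsRegularOfDegree (q + 1)) :
    lp (fun _ : V => ℝ) 2 →L[ℝ] lp (fun _ : V => ℝ) 2 := 1 - avgOp G q hG

theorem laplacian_apply {V : Type*} (G : SimpleGraph V) [G.LocallyFinite] (q : ℕ)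
    (hG : G.IsRegularOfDegree (q + 1)) (f : lp (fun _ : V => ℝ) 2) (x : V) :
    laplacian G q hG f x = f x - 1 / ((q : ℝ) + 1) * ∑ y ∈ G.neighborFinset x, f y := by
  rw [one_div]; rfl

open Classical in
/-- The heat kernel `h_t(x) = (e^{-tΔ} δ_o)(x)` with pole at the vertex `o`. -/
def heatKernel {V : Type*} (G : SimpleGraph V) [G.LocallyFinite] (q : ℕ)
    (hG : G.IsRegularOfDegree (q + 1)) (o : V) (t : ℝ) (x : V) : ℝ :=
  (NormedSpace.exp (-t • laplacian G q hG)) (lp.single 2 o 1) x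

/-- The function `z ↦ exp (-t z^{α/2})` on the closed right half-plane (principal branch). -/
def stableSymbol (α t : ℝ) (z : ℂ) : ℂ := Complex.exp (-(t * z ^ ((α / 2 : ℝ) : ℂ)))

/-- The density `η_t(u)` of the `α/2`-stable subordinator at time `t`, as an inverse Laplace (Bromwich)
integral along the imaginary axis,
`η_t(u) = (2π)⁻¹ ∫_ℝ e^{iyu} exp (-t (iy)^{α/2}) dy`.
Theorem `laplace_stableDensity` shows that it is the function on `(0, ∞)` with Laplace transform
`exp (-t λ^{α/2})`. -/
def stableDensity (α t u : ℝ) : ℝ :=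
  (2 * Real.pi)⁻¹ *
    (∫ y : ℝ, Complex.exp ((Complex.I * y) * u) * stableSymbol α t (Complex.I * y)).re

lemma norm_stableSymbol_le {α t : ℝ} (h0 : 0 < α) (h2 : α < 2) (ht : 0 < t) {z : ℂ}
    (hz : 0 ≤ z.re) :
    ‖stableSymbol α t z‖ ≤
      Real.exp (-(t * Real.cos (Real.pi / 2 * (α / 2))) * ‖z‖ ^ (α / 2)) := by
  have hpi := Real.pi_pos
  rw [stableSymbol, Complex.norm_exp, Complex.cpow_ofReal]
  apply Real.exp_le_exp.2
  simp only [Complex.neg_re, Complex.add_re, Complex.ofReal_re,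
    Complex.mul_re, Complex.I_re, Complex.I_im, Complex.ofReal_im, mul_zero, mul_one, sub_zero,
    add_zero]
  have harg := Complex.abs_arg_le_pi_div_two_iff.2 hz
  have hcos : Real.cos (Real.pi / 2 * (α / 2)) ≤ Real.cos (z.arg * (α / 2)) := by
    rw [← Real.cos_abs (z.arg * (α / 2))]
    apply Real.cos_le_cos_of_nonneg_of_le_pi (abs_nonneg _)
    · nlinarith
    · rw [abs_mul, abs_of_pos (by positivity : 0 < α / 2)]
      gcongr
  have : 0 ≤ ‖z‖ ^ (α / 2) := by positivity
  have := mul_le_mul_of_nonneg_left hcos (mul_nonneg ht.le this)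
  linarith

lemma stable_cos_pos {α : ℝ} (h0 : 0 < α) (h2 : α < 2) :
    0 < Real.cos (Real.pi / 2 * (α / 2)) := by
  have hpi := Real.pi_pos
  apply Real.cos_pos_of_mem_Ioo
  constructor <;> nlinarith

lemma continuousAt_stableSymbol {α t : ℝ} (h0 : 0 < α) {z : ℂ} (hz : 0 ≤ z.re) :
    ContinuousAt (stableSymbol α t) z := by
  unfold stableSymbol
  have := Complex.continuousAt_cpow_const_of_re_pos (z := z) (w := ((α / 2 : ℝ) : ℂ)) (Or.inl hz)
    (by simpa using h0)
  fun_prop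

lemma differentiableAt_stableSymbol {α t : ℝ} {z : ℂ} (hz : 0 < z.re) :
    DifferentiableAt ℂ (stableSymbol α t) z := by
  unfold stableSymbol
  have : DifferentiableAt ℂ (fun z : ℂ => z ^ ((α / 2 : ℝ) : ℂ)) z :=
    differentiableAt_id.cpow_const (Or.inl hz)
  fun_prop

lemma integrable_exp_neg_abs_rpow {a c : ℝ} (ha : 0 < a) (hc : 0 < c) :
    Integrable fun y : ℝ => Real.exp (-c * |y| ^ a) := by
  have h := integrableOn_rpow_mul_exp_neg_mul_rpow (s := 0) (by norm_num) ha hc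
  simp only [Real.rpow_zero, one_mul] at h
  have h1 : IntegrableOn (fun y : ℝ => Real.exp (-c * |y| ^ a)) (Ioi 0) :=
    h.congr_fun (fun y hy => by simp only [abs_of_pos (mem_Ioi.1 hy)]) measurableSet_Ioi
  have h2 : IntegrableOn (fun y : ℝ => Real.exp (-c * |y| ^ a)) (Iio 0) := by
    have := h1.comp_neg
    simpa using this
  have h3 := (h2.union (integrableOn_singleton (x := (0:ℝ)) (by simp) (by simp))).union h1
  rw [Iio_union_right, Iic_union_Ioi] at h3
  exact integrableOn_univ.1 h3

lemma continuous_stableSymbol_line {α t : ℝ} (h0 : 0 < α) {σ : ℝ} (hσ : 0 ≤ σ) :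
    Continuous fun y : ℝ => stableSymbol α t (σ + y * Complex.I) := by
  rw [continuous_iff_continuousAt]
  intro y
  exact ContinuousAt.comp (g := stableSymbol α t) (f := fun y : ℝ => (σ : ℂ) + y * Complex.I)
    (continuousAt_stableSymbol h0 (by simpa using hσ)) (by fun_prop)

lemma norm_stableSymbol_line_le {α t : ℝ} (h0 : 0 < α) (h2 : α < 2) (ht : 0 < t) {σ : ℝ}
    (hσ : 0 ≤ σ) (y : ℝ) :
    ‖stableSymbol α t (σ + y * Complex.I)‖ ≤
      Real.exp (-(t * Real.cos (Real.pi / 2 * (α / 2))) * |y| ^ (α / 2)) := by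
  refine (norm_stableSymbol_le h0 h2 ht (by simpa using hσ)).trans (Real.exp_le_exp.2 ?_)
  have hc := mul_pos ht (stable_cos_pos h0 h2)
  have : |y| ≤ ‖(σ : ℂ) + y * Complex.I‖ := by
    simpa using Complex.abs_im_le_norm ((σ : ℂ) + y * Complex.I)
  have : |y| ^ (α / 2) ≤ ‖(σ : ℂ) + y * Complex.I‖ ^ (α / 2) := by gcongr
  nlinarith

lemma integrable_stableSymbol_line {α t : ℝ} (h0 : 0 < α) (h2 : α < 2) (ht : 0 < t) {σ : ℝ}
    (hσ : 0 ≤ σ) : Integrable fun y : ℝ => stableSymbol α t (σ + y * Complex.I) :=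
  (integrable_exp_neg_abs_rpow (half_pos h0) (mul_pos ht (stable_cos_pos h0 h2))).mono'
    (continuous_stableSymbol_line h0 hσ).aestronglyMeasurable
    (ae_of_all _ (norm_stableSymbol_line_le h0 h2 ht hσ))

lemma norm_exp_line (σ y u : ℝ) :
    ‖Complex.exp ((σ + y * Complex.I) * u)‖ = Real.exp (σ * u) := by
  rw [Complex.norm_exp]; simp

lemma integrable_stable_line {α t : ℝ} (h0 : 0 < α) (h2 : α < 2) (ht : 0 < t) {σ : ℝ}
    (hσ : 0 ≤ σ) (u : ℝ) :
    Integrable fun y : ℝ => Complex.exp ((σ + y * Complex.I) * u) *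
      stableSymbol α t (σ + y * Complex.I) := by
  apply (integrable_stableSymbol_line h0 h2 ht hσ).bdd_mul (c := Real.exp (σ * u))
  · exact Continuous.aestronglyMeasurable (by fun_prop)
  · exact ae_of_all _ fun y => (norm_exp_line σ y u).le

/-- The Bromwich integral may be taken along any vertical line `Re z = σ ≥ 0`. -/
lemma stable_line_shift {α t : ℝ} (h0 : 0 < α) (h2 : α < 2) (ht : 0 < t) {σ : ℝ}
    (hσ : 0 ≤ σ) (u : ℝ) :
    ∫ y : ℝ, Complex.exp ((σ + y * Complex.I) * u) * stableSymbol α t (σ + y * Complex.I) =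
    ∫ y : ℝ, Complex.exp ((((0 : ℝ) : ℂ) + y * Complex.I) * u) *
      stableSymbol α t (((0 : ℝ) : ℂ) + y * Complex.I) := by
  rcases hσ.eq_or_lt with rfl | hσ'
  · rfl
  set c := t * Real.cos (Real.pi / 2 * (α / 2)) with hc
  have hcpos : 0 < c := mul_pos ht (stable_cos_pos h0 h2)
  let f : ℂ → ℂ := fun z => Complex.exp (z * u) * stableSymbol α t z
  have hrect : ∀ T : ℝ, 0 < T →
      (∫ x : ℝ in (0:ℝ)..σ, f (x + (-T : ℝ) * Complex.I)) -
        (∫ x : ℝ in (0:ℝ)..σ, f (x + (T : ℝ) * Complex.I)) +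
        Complex.I • (∫ y : ℝ in (-T)..T, f ((σ : ℝ) + y * Complex.I)) -
        Complex.I • (∫ y : ℝ in (-T)..T, f ((0 : ℝ) + y * Complex.I)) = 0 := by
    intro T hT
    have := Complex.integral_boundary_rect_eq_zero_of_continuousOn_of_differentiableOn f
      ⟨0, -T⟩ ⟨σ, T⟩ ?_ ?_
    · simpa using this
    · intro z hz
      have hz' : 0 ≤ z.re := by
        have := hz.1
        simp only [mem_preimage, uIcc_of_le hσ] at this
        exact this.1
      have := continuousAt_stableSymbol (t := t) h0 hz'
      apply ContinuousAt.continuousWithinAt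
      fun_prop
    · intro z hz
      have hz' : 0 < z.re := by
        have := hz.1
        simp only [mem_preimage, min_eq_left hσ, max_eq_right hσ] at this
        exact this.1
      have := differentiableAt_stableSymbol (α := α) (t := t) hz'
      apply DifferentiableAt.differentiableWithinAt
      fun_prop
  have hdecay : Tendsto (fun T : ℝ => Real.exp (|σ| * |u|) * Real.exp (-c * T ^ (α / 2)) * |σ|)
      atTop (𝓝 0) := by
    have h1 : Tendsto (fun T : ℝ => c * T ^ (α / 2)) atTop atTop :=
      (tendsto_rpow_atTop (half_pos h0)).const_mul_atTop hcpos
    have h2 : Tendsto (fun T : ℝ => Real.exp (-c * T ^ (α / 2))) atTop (𝓝 0) := by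
      simpa [Function.comp_def] using Real.tendsto_exp_neg_atTop_nhds_zero.comp h1
    simpa using (h2.const_mul (Real.exp (|σ| * |u|))).mul_const |σ|
  have hhor : ∀ s : ℝ, |s| = 1 → Tendsto
      (fun T : ℝ => ∫ x : ℝ in (0:ℝ)..σ, f (x + ((s * T : ℝ) : ℂ) * Complex.I)) atTop (𝓝 0) := by
    intro s hs
    apply squeeze_zero_norm' _ hdecay
    filter_upwards [eventually_gt_atTop 0] with T hT
    have := intervalIntegral.norm_integral_le_of_norm_le_const (a := (0:ℝ)) (b := σ)
      (f := fun x : ℝ => f (x + ((s * T : ℝ) : ℂ) * Complex.I))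
      (C := Real.exp (|σ| * |u|) * Real.exp (-c * T ^ (α / 2))) ?_
    · simpa using this
    · intro x hx
      rw [uIoc_of_le hσ] at hx
      simp only [f, norm_mul]
      gcongr
      · rw [norm_exp_line]
        apply Real.exp_le_exp.2
        rw [abs_of_pos hσ']
        calc x * u ≤ x * |u| := by gcongr; exacts [hx.1.le, le_abs_self u]
          _ ≤ _ := by gcongr; exact hx.2
      · have := norm_stableSymbol_line_le h0 h2 ht hx.1.le (s * T)
        rw [abs_mul, hs, one_mul, abs_of_pos hT] at this
        exact this
  have hv : ∀ τ : ℝ, 0 ≤ τ → Tendsto (fun T : ℝ => ∫ y : ℝ in (-T)..T, f ((τ : ℝ) + y * Complex.I))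
      atTop (𝓝 (∫ y : ℝ, f ((τ : ℝ) + y * Complex.I))) := fun τ hτ =>
    intervalIntegral_tendsto_integral (integrable_stable_line h0 h2 ht hτ u)
      tendsto_neg_atTop_atBot tendsto_id
  have hlim := (((hhor (-1) (by simp)).sub (hhor 1 (by simp))).add
    ((hv σ hσ).const_smul Complex.I)).sub ((hv 0 le_rfl).const_smul Complex.I)
  have hz : Tendsto (fun _ : ℝ => (0 : ℂ)) atTop (𝓝 0) := tendsto_const_nhds
  have := tendsto_nhds_unique (hlim.congr' ?_) hz
  · simp only [sub_zero, zero_add, smul_eq_mul, ← mul_sub] at this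
    have := (mul_eq_zero.1 this).resolve_left Complex.I_ne_zero
    exact sub_eq_zero.1 this
  · filter_upwards [eventually_gt_atTop 0] with T hT
    simpa using hrect T hT

lemma stable_integral_eq {α t : ℝ} (h0 : 0 < α) (h2 : α < 2) (ht : 0 < t) {σ : ℝ}
    (hσ : 0 ≤ σ) (u : ℝ) :
    ∫ y : ℝ, Complex.exp ((Complex.I * y) * u) * stableSymbol α t (Complex.I * y) =
    Real.exp (σ * u) *
      ∫ y : ℝ, Complex.exp ((y * u : ℝ) * Complex.I) * stableSymbol α t (σ + y * Complex.I) := by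
  have := stable_line_shift h0 h2 ht hσ u
  simp only [Complex.ofReal_zero, zero_add] at this
  rw [← integral_const_mul]
  simp only [mul_comm Complex.I]
  rw [← this]
  congr 1
  ext y
  rw [← mul_assoc, Complex.ofReal_exp, ← Complex.exp_add]
  congr 2
  push_cast; ring

lemma norm_stable_integral_le {α t : ℝ} (h0 : 0 < α) (h2 : α < 2) (ht : 0 < t) {σ : ℝ}
    (hσ : 0 ≤ σ) (u : ℝ) :
    ‖∫ y : ℝ, Complex.exp ((Complex.I * y) * u) * stableSymbol α t (Complex.I * y)‖ ≤
    Real.exp (σ * u) * ∫ y : ℝ, 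
      Real.exp (-(t * Real.cos (Real.pi / 2 * (α / 2))) * |y| ^ (α / 2)) := by
  rw [stable_integral_eq h0 h2 ht hσ, norm_mul, Complex.norm_real,
    Real.norm_of_nonneg (Real.exp_pos _).le]
  gcongr
  apply norm_integral_le_of_norm_le
    (integrable_exp_neg_abs_rpow (half_pos h0) (mul_pos ht (stable_cos_pos h0 h2)))
  refine ae_of_all _ fun y => ?_
  rw [norm_mul, Complex.norm_exp_ofReal_mul_I, one_mul]
  exact norm_stableSymbol_line_le h0 h2 ht hσ y

lemma stable_integral_eq_zero {α t : ℝ} (h0 : 0 < α) (h2 : α < 2) (ht : 0 < t) {u : ℝ}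
    (hu : u < 0) :
    ∫ y : ℝ, Complex.exp ((Complex.I * y) * u) * stableSymbol α t (Complex.I * y) = 0 := by
  rw [← norm_le_zero_iff]
  have h : Tendsto (fun σ : ℝ => Real.exp (σ * u) * ∫ y : ℝ, 
      Real.exp (-(t * Real.cos (Real.pi / 2 * (α / 2))) * |y| ^ (α / 2))) atTop (𝓝 0) := by
    have : Tendsto (fun σ : ℝ => Real.exp (σ * u)) atTop (𝓝 0) :=
      Real.tendsto_exp_atBot.comp (tendsto_id.atTop_mul_const_of_neg hu)
    simpa using this.mul_const _
  apply ge_of_tendsto h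
  filter_upwards [eventually_ge_atTop 0] with σ hσ
  exact norm_stable_integral_le h0 h2 ht hσ u

lemma continuous_stable_integral {α t : ℝ} (h0 : 0 < α) (h2 : α < 2) (ht : 0 < t) :
    Continuous fun u : ℝ =>
      ∫ y : ℝ, Complex.exp ((Complex.I * y) * u) * stableSymbol α t (Complex.I * y) := by
  have hS := continuous_stableSymbol_line (t := t) h0 le_rfl
  have hI := (integrable_stableSymbol_line h0 h2 ht le_rfl).norm
  simp only [Complex.ofReal_zero, zero_add, mul_comm _ Complex.I] at hS hI
  refine continuous_of_dominated (fun u => Continuous.aestronglyMeasurable (by fun_prop))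
    (fun u => ae_of_all _ fun y => ?_) hI (ae_of_all _ fun y => by fun_prop)
  rw [norm_mul, Complex.norm_exp]
  simp

/-- The defining property of the subordinator: `η_t` has Laplace transform `exp (-t λ^{α/2})`. -/
theorem laplace_stableDensity {α t : ℝ} (h0 : 0 < α) (h2 : α < 2) (ht : 0 < t) {l : ℝ}
    (hl : 0 < l) :
    IntegrableOn (fun u => Real.exp (-l * u) * stableDensity α t u) (Ioi 0) ∧
      ∫ u in Ioi (0 : ℝ), Real.exp (-l * u) * stableDensity α t u =
        Real.exp (-t * l ^ (α / 2)) := by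
  set F : ℝ → ℂ := fun u =>
    ∫ y : ℝ, Complex.exp ((Complex.I * y) * u) * stableSymbol α t (Complex.I * y) with hF
  have hFc : Continuous F := continuous_stable_integral h0 h2 ht
  set h : ℝ → ℂ := fun w => stableSymbol α t (l + (2 * Real.pi * w : ℝ) * Complex.I) with hh
  have hhi : Integrable h := 
    (integrable_stableSymbol_line h0 h2 ht hl.le).comp_mul_left' (by positivity)
  have hinv : 𝓕⁻ h = fun u => (((2 * Real.pi)⁻¹ * Real.exp (-l * u) : ℝ) : ℂ) * F u := by
    ext u
    rw [Real.fourierInv_eq', hF]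
    simp only
    rw [stable_integral_eq h0 h2 ht hl.le]
    have := Measure.integral_comp_mul_left (fun y : ℝ => Complex.exp ((y * u : ℝ) * Complex.I) *
      stableSymbol α t (l + y * Complex.I)) (2 * Real.pi)
    simp only [hh, smul_eq_mul]
    have e : (fun v : ℝ => Complex.exp (((2 * Real.pi * inner ℝ v u : ℝ) : ℂ) * Complex.I) *
        stableSymbol α t (l + ((2 * Real.pi * v : ℝ) : ℂ) * Complex.I)) =
        fun v : ℝ => Complex.exp (((2 * Real.pi * v * u : ℝ) : ℂ) * Complex.I) *
          stableSymbol α t (l + ((2 * Real.pi * v : ℝ) : ℂ) * Complex.I) := by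
      ext v
      have : inner ℝ v u = v * u := by simp [mul_comm]
      rw [this, ← mul_assoc]
    rw [e, this, abs_of_pos (by positivity), Complex.real_smul, ← mul_assoc, ← Complex.ofReal_mul,
      mul_assoc _ (Real.exp _), ← Real.exp_add]
    simp
  have hFb : ∀ u, ‖F u‖ ≤ ∫ y : ℝ,
      Real.exp (-(t * Real.cos (Real.pi / 2 * (α / 2))) * |y| ^ (α / 2)) := fun u => by
    simpa using norm_stable_integral_le h0 h2 ht le_rfl u
  have hzero : ∀ u : ℝ, u ∉ Ioi (0 : ℝ) → u ≠ 0 → 𝓕⁻ h u = 0 := fun u hu hu0 => by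
    rw [hinv]
    simp only [hF]
    rw [stable_integral_eq_zero h0 h2 ht (lt_of_le_of_ne (not_lt.1 hu) hu0), mul_zero]
  have hzero' : ∀ᵐ u : ℝ, u ∉ Ioi (0 : ℝ) → 𝓕⁻ h u = 0 := by
    filter_upwards [Measure.ae_ne volume (0 : ℝ)] with u hu0 hu using hzero u hu hu0
  have hintOn : IntegrableOn (𝓕⁻ h) (Ioi 0) := by
    rw [hinv]
    refine Integrable.mul_bdd (c := _) ?_ hFc.aestronglyMeasurable (ae_of_all _ hFb)
    exact (((integrableOn_exp_mul_Ioi (neg_lt_zero.2 hl) 0).const_mul _).ofReal)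
  have hint : Integrable (𝓕⁻ h) := hintOn.integrable_of_ae_notMem_eq_zero hzero'
  have hint' : Integrable (𝓕 h) := by
    have : 𝓕 h = fun u => 𝓕⁻ h (-u) := by
      ext u; rw [Real.fourierInv_eq_fourier_neg, neg_neg]
    rw [this]
    exact hint.comp_neg
  have hcont : ContinuousAt h 0 :=
    ((continuous_stableSymbol_line h0 hl.le).comp (by fun_prop : Continuous fun w : ℝ =>
      2 * Real.pi * w)).continuousAt
  have key := hhi.fourier_fourierInv_eq hint' hcont
  have hre : ∀ u, Real.exp (-l * u) * stableDensity α t u = RCLike.re (𝓕⁻ h u) := fun u => by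
    rw [hinv]
    simp only [stableDensity, RCLike.re_eq_complex_re, Complex.re_ofReal_mul, hF]
    ring
  simp only [hre]
  refine ⟨hintOn.re, ?_⟩
  rw [integral_re hintOn, setIntegral_eq_integral_of_ae_compl_eq_zero hzero']
  rw [Real.fourier_eq'] at key
  simp only [inner_zero_right, mul_zero, Complex.ofReal_zero, zero_mul, Complex.exp_zero,
    one_smul] at key
  rw [key]
  simp only [hh, stableSymbol, mul_zero, Complex.ofReal_zero, zero_mul, add_zero]
  rw [← Complex.ofReal_cpow hl.le, ← Complex.ofReal_mul, ← Complex.ofReal_neg, ← Complex.ofReal_exp,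
    RCLike.re_eq_complex_re, Complex.ofReal_re, neg_mul]

/-- The `α`-stable kernel `p_t(x) = ∫_0^∞ h_u(x) η_t(u) du` with pole at the vertex `o`, i.e. the kernel
of the subordinate semigroup `e^{-t Δ^{α/2}}`. -/
def stableKernel {V : Type*} (G : SimpleGraph V) [G.LocallyFinite] (q : ℕ)
    (hG : G.IsRegularOfDegree (q + 1)) (o : V) (α t : ℝ) (x : V) : ℝ :=
  ∫ u in Ioi (0 : ℝ), heatKernel G q hG o u x * stableDensity α t u

end

end HomogeneousTree

namespace HomogeneousTree

open MeasureTheory Filter Topology Set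

/-! `heatKernel` is the law at time `u` of a rate-one random walk from `o`. Away from `o` a step
goes outward with probability `q/(q+1)`, so the walk escapes at linear speed and its mass at time
`u` sits at distance of order `u`. The stable density at time `t` lives at `u` of order `t^(2/α)`,
so `p_t` puts its mass at distance of order `t^(2/α)`, and an annulus at scale `t^β` with `β ≠ 2/α`
is missed.

Linear speed is made quantitative by Chernoff bounds: if `f ≥ 0` and `A f ≤ ρ f`, then the
`h_u`-integral of `f` is at most `e^(-(1-ρ)u) f(o)`. The weight `2^|x|` bounds the mass far out
(`sum_heatKernel_far_le`), and `(2/3)^|x|` the mass near `o` (`sum_heatKernel_near_le`); the latter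
is where `q ≥ 2` enters.

Self-similarity (`stableDensity_mul`) turns `η_t(u) du` into `η_1(v) dv` under `u = t^(2/α) v`. For
each fixed `v > 0` the mass of the annulus tends to `0`, and dominated convergence with majorant
`|η_1|` concludes. Positivity of `η_1` is never needed, only absolute integrability
(`integrableOn_stableDensity`). This follows from decay like `u^(-1-α/2)`, read off the singularity
of the symbol at `0` by a second-difference argument. -/

/-- Uniqueness of the parent. In a tree adjacent distances differ by exactly one, so a geodesic from
`o` to such a neighbour extends by one edge to a path ending at `x`. That path is unique, and its
penultimate vertex is the neighbour. -/
lemma dist_eq_of_adj_of_dist_le {V : Type*} {G : SimpleGraph V} (hT : G.IsTree) {o x y z : V}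
    (hy : G.Adj x y) (hz : G.Adj x z) (hyx : G.dist o y ≤ G.dist o x)
    (hzx : G.dist o z ≤ G.dist o x) : y = z := by
  have key : ∀ w, G.Adj x w → G.dist o w ≤ G.dist o x →
      ∃ p : G.Walk o x, p.IsPath ∧ p.penultimate = w := by
    intro w hw hwx
    obtain ⟨p, -, hlen⟩ := hT.connected.exists_path_of_dist o w
    refine ⟨p.concat hw.symm, ?_, by simp⟩
    apply SimpleGraph.Walk.isPath_of_length_eq_dist
    rw [SimpleGraph.Walk.length_concat, hlen]
    rcases hT.dist_eq_dist_add_one_of_adj o hw with h | h <;> omega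
  obtain ⟨p, hp, rfl⟩ := key y hy hyx
  obtain ⟨p', hp', rfl⟩ := key z hz hzx
  rw [(hT.existsUnique_path o x).unique hp hp']

/-! ### Heat kernel: Poisson series and exponential moments. -/

section HeatKernel

variable {V : Type*} (G : SimpleGraph V) [G.LocallyFinite] (q : ℕ)
    (hG : G.IsRegularOfDegree (q + 1))

lemma avgOp_apply (f : lp (fun _ : V => ℝ) 2) (x : V) :
    avgOp G q hG f x = ((q : ℝ) + 1)⁻¹ * ∑ y ∈ G.neighborFinset x, f y := rfl

open Classical in
lemma avgOp_pow_single_nonneg (o : V) (n : ℕ) (x : V) :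
    0 ≤ (avgOp G q hG ^ n) (lp.single 2 o 1) x := by
  induction n generalizing x with
  | zero =>
    simp only [pow_zero, one_apply_eq_self, lp.single_apply, Pi.single_apply]
    split_ifs <;> simp
  | succ n ih =>
    rw [pow_succ', mul_apply_eq_comp, avgOp_apply]
    exact mul_nonneg (by positivity) (Finset.sum_nonneg fun y _ => ih y)

open Classical in
/-- If `f ≥ 0` satisfies `A f ≤ ρ f` pointwise, then `⟨A ^ n δ_o, f⟩ ≤ ρ ^ n f o`, tested on finite
sets. -/
lemma sum_avgOp_pow_single_mul_le (o : V) {f : V → ℝ} {ρ : ℝ} (hf : ∀ x, 0 ≤ f x) (hρ : 0 ≤ ρ)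
    (hAf : ∀ x, ((q : ℝ) + 1)⁻¹ * ∑ y ∈ G.neighborFinset x, f y ≤ ρ * f x) (n : ℕ)
    (s : Finset V) :
    ∑ x ∈ s, (avgOp G q hG ^ n) (lp.single 2 o 1) x * f x ≤ ρ ^ n * f o := by
  induction n generalizing s with
  | zero =>
    simp only [pow_zero, one_apply_eq_self, lp.single_apply, Pi.single_apply, one_mul,
      ite_mul, zero_mul, Finset.sum_ite_eq']
    split_ifs
    exacts [le_rfl, hf o]
  | succ n ih =>
    set a : V → ℝ := fun x => (avgOp G q hG ^ n) (lp.single 2 o 1) x with ha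
    have ha0 : ∀ x, 0 ≤ a x := avgOp_pow_single_nonneg G q hG o n
    let T := s.biUnion fun x => G.neighborFinset x
    calc ∑ x ∈ s, (avgOp G q hG ^ (n + 1)) (lp.single 2 o 1) x * f x
        = ∑ x ∈ s, ∑ y ∈ G.neighborFinset x, ((q : ℝ) + 1)⁻¹ * (a y * f x) := by
          refine Finset.sum_congr rfl fun x _ => ?_
          rw [pow_succ', mul_apply_eq_comp, avgOp_apply, ← Finset.mul_sum,
            ← Finset.sum_mul, mul_assoc]
      _ = ∑ y ∈ T, ∑ x ∈ s with G.Adj y x, ((q : ℝ) + 1)⁻¹ * (a y * f x) := by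
          apply Finset.sum_comm'
          intro x y
          simp only [SimpleGraph.mem_neighborFinset, Finset.mem_filter, Finset.mem_biUnion, T]
          constructor
          · rintro ⟨h, h'⟩; exact ⟨⟨h, h'.symm⟩, x, h, h'⟩
          · rintro ⟨⟨h, h'⟩, _⟩; exact ⟨h, h'.symm⟩
      -- Positivity allows the inner sum to run over all neighbours of `y`, so that `hAf` applies;
      -- the induction hypothesis is then used on the larger finite set `T`.
      _ ≤ ∑ y ∈ T, ∑ x ∈ G.neighborFinset y, ((q : ℝ) + 1)⁻¹ * (a y * f x) := by
          refine Finset.sum_le_sum fun y _ => ?_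
          refine Finset.sum_le_sum_of_subset_of_nonneg (fun x hx => ?_) fun x _ _ => ?_
          · simpa using (Finset.mem_filter.1 hx).2
          · exact mul_nonneg (by positivity) (mul_nonneg (ha0 y) (hf x))
      _ = ∑ y ∈ T, a y * (((q : ℝ) + 1)⁻¹ * ∑ x ∈ G.neighborFinset y, f x) := by
          refine Finset.sum_congr rfl fun y _ => ?_
          rw [← Finset.mul_sum, ← Finset.mul_sum, mul_left_comm]
      _ ≤ ∑ y ∈ T, ρ * (a y * f y) := by
          refine Finset.sum_le_sum fun y _ => ?_
          rw [mul_left_comm ρ]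
          exact mul_le_mul_of_nonneg_left (hAf y) (ha0 y)
      _ ≤ ρ ^ (n + 1) * f o := by
          rw [← Finset.mul_sum, pow_succ', mul_assoc]
          exact mul_le_mul_of_nonneg_left (ih T) hρ

open Classical in
-- Since `Δ = 1 - A` and scalars commute with `A`, `e^(-uΔ) = e^(-u) e^(uA)`: the walk run at
-- Poisson times. For `u ≥ 0` all terms are nonnegative, which `e^(-uΔ)` itself does not show.
lemma hasSum_heatKernel (o : V) (u : ℝ) (x : V) :
    HasSum (fun n : ℕ => Real.exp (-u) * ((n.factorial : ℝ)⁻¹ * u ^ n *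
      (avgOp G q hG ^ n) (lp.single 2 o 1) x)) (heatKernel G q hG o u x) := by
  let _ : NormedAlgebra ℚ (lp (fun _ : V => ℝ) 2 →L[ℝ] lp (fun _ : V => ℝ) 2) :=
    NormedAlgebra.restrictScalars ℚ ℝ _
  have h1 : NormedSpace.exp (-u • laplacian G q hG) =
      Real.exp (-u) • NormedSpace.exp (u • avgOp G q hG) := by
    have : -u • laplacian G q hG =
        algebraMap ℝ (lp (fun _ : V => ℝ) 2 →L[ℝ] lp (fun _ : V => ℝ) 2) (-u) +
          u • avgOp G q hG := by
      rw [laplacian, Algebra.algebraMap_eq_smul_one, smul_sub]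
      simp
    rw [this, NormedSpace.exp_add_of_commute (Algebra.commutes _ _),
      ← NormedSpace.algebraMap_exp_comm, ← Algebra.smul_def, Real.exp_eq_exp_ℝ]
  have h2 := NormedSpace.exp_series_hasSum_exp' (𝕂 := ℝ) (u • avgOp G q hG)
  have h3 := ((h2.mapL (ContinuousLinearMap.apply ℝ _ (lp.single 2 o (1 : ℝ)))).mapL
    (lp.evalCLM ℝ (fun _ : V => ℝ) 2 x)).mul_left (Real.exp (-u))
  rw [heatKernel, h1]
  refine (congrArg (HasSum · _) (funext fun n => ?_)).mpr h3
  rw [smul_pow, smul_smul]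
  rfl

lemma heatKernel_nonneg (o : V) {u : ℝ} (hu : 0 ≤ u) (x : V) : 0 ≤ heatKernel G q hG o u x :=
  (hasSum_heatKernel G q hG o u x).nonneg fun n => by
    have := avgOp_pow_single_nonneg G q hG o n x
    positivity

/-- Weighting the bounds `ρ^n f(o)` by the Poisson series gives `e^(-u) e^(ρu)`. Finite sums keep
unbounded weights `f`, outside `ℓ²`, admissible. -/
lemma sum_heatKernel_mul_le (o : V) {f : V → ℝ} {ρ : ℝ} (hf : ∀ x, 0 ≤ f x) (hρ : 0 ≤ ρ)
    (hAf : ∀ x, ((q : ℝ) + 1)⁻¹ * ∑ y ∈ G.neighborFinset x, f y ≤ ρ * f x) {u : ℝ} (hu : 0 ≤ u)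
    (s : Finset V) :
    ∑ x ∈ s, heatKernel G q hG o u x * f x ≤ Real.exp (-((1 - ρ) * u)) * f o := by
  classical
  have h1 := hasSum_sum fun x (_ : x ∈ s) => (hasSum_heatKernel G q hG o u x).mul_right (f x)
  have h2 := ((NormedSpace.exp_series_hasSum_exp' (𝕂 := ℝ) (u * ρ)).mul_left
    (Real.exp (-u))).mul_right (f o)
  rw [← Real.exp_eq_exp_ℝ, ← Real.exp_add] at h2
  rw [show -((1 - ρ) * u) = -u + u * ρ by ring]
  refine hasSum_le (fun n => ?_) h1 h2
  have h3 := sum_avgOp_pow_single_mul_le G q hG o hf hρ hAf n s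
  have h4 : 0 ≤ Real.exp (-u) * ((n.factorial : ℝ)⁻¹ * u ^ n) := by positivity
  calc _ = Real.exp (-u) * ((n.factorial : ℝ)⁻¹ * u ^ n) *
        ∑ x ∈ s, (avgOp G q hG ^ n) (lp.single 2 o 1) x * f x := by
        rw [Finset.mul_sum]
        exact Finset.sum_congr rfl fun x _ => by ring
    _ ≤ _ := mul_le_mul_of_nonneg_left h3 h4
    _ = _ := by rw [smul_eq_mul, mul_pow]; ring

lemma sum_neighborFinset_const {V : Type*} (G : SimpleGraph V) [G.LocallyFinite] (q : ℕ)
    (hG : G.IsRegularOfDegree (q + 1)) (c : ℝ) (x : V) :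
    ∑ _y ∈ G.neighborFinset x, c = ((q : ℝ) + 1) * c := by
  rw [Finset.sum_const, nsmul_eq_mul, G.card_neighborFinset_eq_degree, hG x]
  push_cast; rfl

lemma sum_heatKernel_le_one (o : V) {u : ℝ} (hu : 0 ≤ u) (s : Finset V) :
    ∑ x ∈ s, heatKernel G q hG o u x ≤ 1 := by
  have := sum_heatKernel_mul_le G q hG o (f := fun _ => 1) (ρ := 1) (fun _ => zero_le_one)
    zero_le_one (fun x => by
      rw [sum_neighborFinset_const G q hG, inv_mul_cancel_left₀ (by positivity), one_mul]) hu s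
  simpa using this

/-- Markov's inequality for `2^|x|`: one step moves outward by at most one, so averaging at most
doubles this weight. -/
lemma sum_heatKernel_far_le (hT : G.IsTree) (o : V) {u : ℝ} (hu : 0 ≤ u) {R : ℝ} (s : Finset V)
    (hs : ∀ x ∈ s, R ≤ G.dist o x) :
    ∑ x ∈ s, heatKernel G q hG o u x ≤ Real.exp (u - Real.log 2 * R) := by
  have h1 := sum_heatKernel_mul_le G q hG o (f := fun x => 2 ^ G.dist o x) (ρ := 2)
    (fun _ => by positivity) zero_le_two (fun x => by
      rw [inv_mul_le_iff₀ (by positivity), ← sum_neighborFinset_const G q hG _ x]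
      refine Finset.sum_le_sum fun y hy => ?_
      rw [← pow_succ']
      refine pow_le_pow_right₀ one_le_two ?_
      rcases hT.dist_eq_dist_add_one_of_adj o ((G.mem_neighborFinset x y).1 hy) with h | h <;>
        omega) hu s
  have h2 : ∑ x ∈ s, heatKernel G q hG o u x * Real.exp (Real.log 2 * R) ≤ _ :=
    (Finset.sum_le_sum fun x hx => mul_le_mul_of_nonneg_left (?_ : _ ≤ (2 : ℝ) ^ G.dist o x)
      (heatKernel_nonneg G q hG o hu x)).trans h1
  · rw [← Finset.sum_mul, SimpleGraph.dist_self, pow_zero, mul_one] at h2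
    rw [Real.exp_sub, le_div_iff₀ (Real.exp_pos _)]
    rwa [show -((1 - 2) * u) = u by ring] at h2
  · rw [← Real.rpow_natCast, Real.rpow_def_of_pos two_pos]
    have := Real.log_pos one_lt_two
    gcongr
    exact hs x hx

/-- Markov's inequality for `f = (2/3)^|x|`. At `x ≠ o` one neighbour is nearer and `q` are farther,
so `A f / f = (3/2 + 2q/3)/(q+1)`. This decreases in `q` and equals `17/18` at `q = 2`, giving the
rate `1 - 17/18 = 1/18`. -/
lemma sum_heatKernel_near_le (hT : G.IsTree) (hq : 2 ≤ q) (o : V) {u : ℝ} (hu : 0 ≤ u) {R : ℝ}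
    (s : Finset V) (hs : ∀ x ∈ s, (G.dist o x : ℝ) ≤ R) :
    ∑ x ∈ s, heatKernel G q hG o u x ≤ Real.exp (Real.log (3 / 2) * R - u / 18) := by
  classical
  have h1 := sum_heatKernel_mul_le G q hG o (f := fun x => (2 / 3) ^ G.dist o x) (ρ := 17 / 18)
    (fun _ => by positivity) (by norm_num) (fun x => by
      have hq' : (2 : ℝ) ≤ q := by exact_mod_cast hq
      have hc := sum_neighborFinset_const G q hG ((2 / 3) ^ (G.dist o x + 1)) x
      rw [inv_mul_le_iff₀ (by positivity)]
      by_cases h : ∃ y ∈ G.neighborFinset x, G.dist o y ≤ G.dist o x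
      · obtain ⟨y, hy, hyx⟩ := h
        have hadj := (G.mem_neighborFinset x y).1 hy
        have hd : G.dist o x = G.dist o y + 1 := by
          rcases hT.dist_eq_dist_add_one_of_adj o hadj with h | h <;> omega
        have hother : ∀ z ∈ (G.neighborFinset x).erase y,
            ((2 : ℝ) / 3) ^ G.dist o z = (2 / 3) ^ (G.dist o x + 1) := fun z hz => by
          obtain ⟨hzy, hz⟩ := Finset.mem_erase.1 hz
          have hz' := (G.mem_neighborFinset x z).1 hz
          rcases hT.dist_eq_dist_add_one_of_adj o hz' with h | h
          · exact absurd (dist_eq_of_adj_of_dist_le hT hz' hadj (by omega) hyx) hzy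
          · rw [h]
        -- Splitting off the parent in the constant sum `hc` as well evaluates the sum over the
        -- children without counting them.
        rw [← Finset.add_sum_erase _ _ hy] at hc ⊢
        rw [Finset.sum_congr rfl hother, hd]
        rw [hd] at hc
        have hp : (0 : ℝ) < (2 / 3) ^ G.dist o y := by positivity
        simp only [pow_succ] at hc ⊢
        nlinarith
      -- Only `x = o` has no nearer neighbour; there the ratio is `2/3 ≤ 17/18`.
      · push Not at h
        rw [Finset.sum_congr rfl fun y hy => ?_, hc]
        · have hp : (0 : ℝ) < (2 / 3) ^ G.dist o x := by positivity
          simp only [pow_succ]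
          nlinarith
        · have := h y hy
          rcases hT.dist_eq_dist_add_one_of_adj o ((G.mem_neighborFinset x y).1 hy) with h | h
          · omega
          · rw [h]) hu s
  have h2 : ∑ x ∈ s, heatKernel G q hG o u x * Real.exp (-(Real.log (3 / 2) * R)) ≤ _ :=
    (Finset.sum_le_sum fun x hx => mul_le_mul_of_nonneg_left (?_ : _ ≤ (2 / 3 : ℝ) ^ G.dist o x)
      (heatKernel_nonneg G q hG o hu x)).trans h1
  · rw [← Finset.sum_mul, SimpleGraph.dist_self, pow_zero, mul_one, Real.exp_neg,
      mul_inv_le_iff₀ (Real.exp_pos _), ← Real.exp_add] at h2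
    rwa [show -((1 - 17 / 18) * u) + Real.log (3 / 2) * R = Real.log (3 / 2) * R - u / 18 by ring]
      at h2
  · rw [← Real.rpow_natCast, Real.rpow_def_of_pos (by norm_num),
      show (2 / 3 : ℝ) = (3 / 2)⁻¹ by norm_num, Real.log_inv, neg_mul]
    have := Real.log_pos (show (1 : ℝ) < 3 / 2 by norm_num)
    gcongr
    exact hs x hx

lemma continuous_heatKernel (o : V) (x : V) : Continuous fun u => heatKernel G q hG o u x := by
  classical
  let _ : NormedAlgebra ℚ (lp (fun _ : V => ℝ) 2 →L[ℝ] lp (fun _ : V => ℝ) 2) :=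
    NormedAlgebra.restrictScalars ℚ ℝ _
  have h : Continuous fun u : ℝ => NormedSpace.exp (-u • laplacian G q hG) :=
    NormedSpace.exp_continuous.comp (by fun_prop)
  exact (lp.evalCLM ℝ (fun _ : V => ℝ) 2 x).continuous.comp
    (h.clm_apply (continuous_const (y := (lp.single 2 o 1 : lp (fun _ : V => ℝ) 2))))

end HeatKernel

/-! ### Stable density: scaling, decay and integrability. -/

section StableDensity

lemma stableSymbol_ofReal_mul {α t r : ℝ} (hr : 0 < r) (z : ℂ) :
    stableSymbol α t (r * z) = stableSymbol α (t * r ^ (α / 2)) z := by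
  rw [stableSymbol, stableSymbol, Complex.ofReal_mul, Complex.cpow_ofReal, Complex.cpow_ofReal,
    Complex.arg_real_mul z hr, norm_mul, Complex.norm_real, Real.norm_of_nonneg hr.le,
    Real.mul_rpow hr.le (norm_nonneg z)]
  push_cast
  ring_nf

/-- Self-similarity of the stable density. -/
lemma stableDensity_mul {α t : ℝ} (h0 : 0 < α) (ht : 0 < t) (s : ℝ) :
    stableDensity α t (t ^ (2 / α) * s) = (t ^ (2 / α))⁻¹ * stableDensity α 1 s := by
  set r := t ^ (2 / α) with hr
  have hr0 : 0 < r := Real.rpow_pos_of_pos ht _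
  -- Rescaling the frequency by `r⁻¹` multiplies the time in the symbol by this factor, so time `t`
  -- becomes time `1`.
  have hra : (r⁻¹) ^ (α / 2) = t⁻¹ := by
    rw [Real.inv_rpow hr0.le, hr, ← Real.rpow_mul ht.le, div_mul_div_comm, mul_comm, div_self,
      Real.rpow_one]
    positivity
  have h := Measure.integral_comp_mul_left (fun y : ℝ => Complex.exp ((Complex.I * y) * (r * s : ℝ))
    * stableSymbol α t (Complex.I * y)) r⁻¹
  rw [inv_inv, abs_of_pos hr0] at h
  have e : ∀ y : ℝ, Complex.exp ((Complex.I * ((r⁻¹ * y : ℝ) : ℂ)) * (r * s : ℝ)) *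
      stableSymbol α t (Complex.I * ((r⁻¹ * y : ℝ) : ℂ)) =
      Complex.exp ((Complex.I * y) * s) * stableSymbol α 1 (Complex.I * y) := fun y => by
    have hrc : (r : ℂ) ≠ 0 := by exact_mod_cast hr0.ne'
    rw [show Complex.I * ((r⁻¹ * y : ℝ) : ℂ) = (r⁻¹ : ℝ) * (Complex.I * y) by push_cast; ring,
      stableSymbol_ofReal_mul (inv_pos.2 hr0), hra, mul_inv_cancel₀ ht.ne']
    congr 2
    push_cast
    field_simp
  simp only [e] at h
  rw [stableDensity, stableDensity, h, Complex.real_smul, Complex.re_ofReal_mul,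
    mul_left_comm r⁻¹, inv_mul_cancel_left₀ hr0.ne']

lemma norm_exp_sub_one_le_two_mul {z : ℂ} (hz : z.re ≤ 0) : ‖Complex.exp z - 1‖ ≤ 2 * ‖z‖ := by
  rcases le_total ‖z‖ 1 with h | h
  · exact Complex.norm_exp_sub_one_le h
  · calc _ ≤ ‖Complex.exp z‖ + ‖(1 : ℂ)‖ := norm_sub_le _ _
      _ ≤ 1 + 1 := by
        rw [Complex.norm_exp, norm_one]
        gcongr
        exact Real.exp_le_one_iff.2 hz
      _ ≤ _ := by linarith

/-- If `Re c > 0` and `0 < a < 1`, the second derivative of `exp (-c y ^ a)` is `O(y ^ (a - 2))`. -/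
lemma exists_hasDerivAt_exp_neg_rpow {a : ℝ} (ha0 : 0 < a) (ha1 : a < 1) {c : ℂ} (hc : 0 < c.re) :
    ∃ G' G'' : ℝ → ℂ, ∃ C : ℝ, 0 ≤ C ∧
      (∀ y : ℝ, 0 < y → HasDerivAt (fun y : ℝ => Complex.exp (-(c * (y ^ a : ℝ)))) (G' y) y) ∧
      (∀ y : ℝ, 0 < y → HasDerivAt G' (G'' y) y) ∧
      ∀ y : ℝ, 0 < y → ‖G'' y‖ ≤ C * y ^ (a - 2) := by
  set G : ℝ → ℂ := fun y => Complex.exp (-(c * (y ^ a : ℝ)))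
  have hG : ∀ y : ℝ, 0 < y → HasDerivAt G (G y * (-(c * (a * y ^ (a - 1) : ℝ)))) y := fun y hy =>
    (((Real.hasDerivAt_rpow_const (p := a) (Or.inl hy.ne')).ofReal_comp.const_mul c).neg).cexp
  refine ⟨fun y => G y * (-(c * (a * y ^ (a - 1) : ℝ))),
    fun y => G y * (-(c * (a * y ^ (a - 1) : ℝ))) * (-(c * (a * y ^ (a - 1) : ℝ))) +
      G y * (-(c * (a * ((a - 1) * y ^ (a - 1 - 1)) : ℝ))),
    ‖c‖ ^ 2 / c.re + ‖c‖, by positivity, hG, fun y hy => ?_, fun y hy => ?_⟩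
  · exact (hG y hy).mul ((((Real.hasDerivAt_rpow_const (p := a - 1)
      (Or.inl hy.ne')).const_mul a).ofReal_comp.const_mul c).neg)
  · have hGn : ‖G y‖ = Real.exp (-(c.re * y ^ a)) := by
      simp only [G, Complex.norm_exp, Complex.neg_re, Complex.re_mul_ofReal]
    have hya : 0 < y ^ a := Real.rpow_pos_of_pos hy a
    have hy2 : 0 < y ^ (a - 2) := Real.rpow_pos_of_pos hy _
    have hG1 : ‖G y‖ ≤ 1 := by
      rw [hGn]
      exact Real.exp_le_one_iff.2 (neg_nonpos.2 (by positivity))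
    -- From `x e^(-x) ≤ 1`. It absorbs the extra `y^a` in `(y^(a-1))² = y^a y^(a-2)`, the square of
    -- the first logarithmic derivative.
    have hG2 : ‖G y‖ * y ^ a ≤ 1 / c.re := by
      rw [hGn, Real.exp_neg, le_div_iff₀ hc, mul_assoc, inv_mul_le_iff₀ (Real.exp_pos _), mul_one]
      linarith [Real.add_one_le_exp (c.re * y ^ a)]
    have e1 : y ^ (a - 1) * y ^ (a - 1) = y ^ a * y ^ (a - 2) := by
      rw [← Real.rpow_add hy, ← Real.rpow_add hy]; ring_nf
    refine (norm_add_le _ _).trans ?_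
    rw [add_mul]
    gcongr
    · simp only [norm_mul, norm_neg, Complex.norm_real, Real.norm_eq_abs, abs_of_pos ha0,
        abs_of_pos (Real.rpow_pos_of_pos hy (a - 1))]
      calc _ = (‖G y‖ * y ^ a) * (‖c‖ ^ 2 * (a * a) * y ^ (a - 2)) := by
            linear_combination (‖G y‖ * ‖c‖ ^ 2 * a * a) * e1
        _ ≤ (1 / c.re) * (‖c‖ ^ 2 * (1 * 1) * y ^ (a - 2)) := by gcongr
        _ = _ := by ring
    · simp only [norm_mul, norm_neg, Complex.norm_real, Real.norm_eq_abs, abs_of_pos ha0,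
        abs_of_pos (Real.rpow_pos_of_pos hy (a - 1 - 1)), abs_of_neg (sub_neg.2 ha1)]
      rw [show a - 1 - 1 = a - 2 by ring]
      calc _ = ‖G y‖ * (‖c‖ * (a * ((1 - a) * y ^ (a - 2)))) := by ring
        _ ≤ 1 * (‖c‖ * (1 * ((1 : ℝ) * y ^ (a - 2)))) := by
            have : 0 ≤ 1 - a := by linarith
            gcongr
            linarith
        _ = _ := by ring

/-- Second differences are bounded by the second derivative. -/
lemma norm_second_difference_le {G G' G'' : ℝ → ℂ} {y h M : ℝ} (hh : 0 ≤ h)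
    (hG : ∀ x ∈ Icc (y - h) (y + h), HasDerivAt G (G' x) x)
    (hG' : ∀ x ∈ Icc (y - h) (y + h), HasDerivAt G' (G'' x) x)
    (hM : ∀ x ∈ Icc (y - h) (y + h), ‖G'' x‖ ≤ M) :
    ‖G (y + h) - 2 * G y + G (y - h)‖ ≤ 2 * M * h ^ 2 := by
  have hM0 : 0 ≤ M := (norm_nonneg _).trans (hM y ⟨by linarith, by linarith⟩)
  -- The mean value inequality is applied to `s ↦ G (y+s) + G (y-s)`, whose derivative is a
  -- difference of values of `G'` and is bounded by the same inequality.
  have hd : ∀ s ∈ Icc 0 h, HasDerivAt (fun s => G (y + s) + G (y - s)) (G' (y + s) - G' (y - s)) s :=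
    fun s hs => by
      have h1 := (hG (y + s) ⟨by linarith [hs.1], by linarith [hs.2]⟩).comp_const_add y s
      have h2 := (hG (y - s) ⟨by linarith [hs.2], by linarith [hs.1]⟩).comp_const_sub y s
      simpa only [sub_eq_add_neg] using h1.fun_add h2
  have hb : ∀ s ∈ Icc 0 h, ‖G' (y + s) - G' (y - s)‖ ≤ 2 * M * h := fun s hs => by
    have := (convex_Icc (y - h) (y + h)).norm_image_sub_le_of_norm_hasDerivWithin_le
      (fun x hx => (hG' x hx).hasDerivWithinAt) hM
      (x := y - s) (y := y + s) ⟨by linarith [hs.2], by linarith [hs.1]⟩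
      ⟨by linarith [hs.1], by linarith [hs.2]⟩
    refine this.trans ?_
    rw [show y + s - (y - s) = 2 * s by ring, Real.norm_of_nonneg (by linarith [hs.1])]
    nlinarith [hs.2]
  have := (convex_Icc 0 h).norm_image_sub_le_of_norm_hasDerivWithin_le
      (fun x hx => (hd x hx).hasDerivWithinAt) hb (left_mem_Icc.2 hh) (right_mem_Icc.2 hh)
  simp only [add_zero, sub_zero, Real.norm_of_nonneg hh] at this
  calc _ = ‖G (y + h) + G (y - h) - (G y + G y)‖ := by congr 1; ring
    _ ≤ _ := this
    _ = _ := by ring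

lemma norm_stableSymbol_sub_one_le {α : ℝ} (h0 : 0 < α) (h2 : α < 2) {z : ℂ} (hz : 0 ≤ z.re) :
    ‖stableSymbol α 1 z - 1‖ ≤ 2 * ‖z‖ ^ (α / 2) := by
  have hre : (-((1 : ℝ) * z ^ ((α / 2 : ℝ) : ℂ))).re ≤ 0 := by
    -- The sign of the real part is equivalent to the symbol having norm at most `1`, which the
    -- earlier norm bound gives.
    rw [← Real.exp_le_one_iff, ← Complex.norm_exp]
    refine (norm_stableSymbol_le h0 h2 one_pos hz).trans (Real.exp_le_one_iff.2 ?_)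
    have := stable_cos_pos h0 h2
    have : 0 ≤ ‖z‖ ^ (α / 2) := by positivity
    nlinarith
  refine (norm_exp_sub_one_le_two_mul hre).trans_eq ?_
  rw [norm_neg, Complex.ofReal_one, one_mul, Complex.norm_cpow_real]

lemma stableSymbol_I_mul_neg {α t : ℝ} (y : ℝ) :
    stableSymbol α t (Complex.I * (-y : ℝ)) =
      (starRingEnd ℂ) (stableSymbol α t (Complex.I * y)) := by
  have harg : (Complex.I * y).arg ≠ Real.pi := by
    intro h
    have := (Complex.arg_eq_pi_iff.1 h).1
    simp at this
  have := Complex.conj_cpow (Complex.I * y) ((α / 2 : ℝ) : ℂ) harg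
  rw [Complex.conj_ofReal] at this
  rw [stableSymbol, stableSymbol, ← Complex.exp_conj, map_neg, map_mul, Complex.conj_ofReal, ← this]
  simp

/-- On `y > 0` the symbol is `exp(-c y^(α/2))` with `c = i^(α/2)` and `Re c = cos(πα/4) > 0`;
negative `y` follows by conjugation. The condition `2h ≤ |y|` keeps the stencil at distance at least
`|y|/2` from the singularity, which costs the factor `(1/2)^(α/2-2)`. -/
lemma exists_norm_second_difference_stableSymbol_le {α : ℝ} (h0 : 0 < α) (h2 : α < 2) :
    ∃ C : ℝ, 0 ≤ C ∧ ∀ h : ℝ, 0 < h → ∀ y : ℝ, 2 * h ≤ |y| →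
      ‖stableSymbol α 1 (Complex.I * (y + h : ℝ)) - 2 * stableSymbol α 1 (Complex.I * y) +
        stableSymbol α 1 (Complex.I * (y - h : ℝ))‖ ≤ C * h ^ 2 * |y| ^ (α / 2 - 2) := by
  set c : ℂ := Complex.I ^ ((α / 2 : ℝ) : ℂ)
  have hc : 0 < c.re := by
    have := stable_cos_pos h0 h2
    simp only [c, Complex.cpow_ofReal, Complex.arg_I, Complex.norm_I, Real.one_rpow,
      Complex.ofReal_one, one_mul, Complex.add_re, Complex.ofReal_re, Complex.re_ofReal_mul,
      Complex.I_re, mul_zero, add_zero]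
    exact this
  have hg : ∀ y : ℝ, 0 < y →
      stableSymbol α 1 (Complex.I * y) = Complex.exp (-(c * (y ^ (α / 2) : ℝ))) := fun y hy => by
    rw [mul_comm, stableSymbol_ofReal_mul hy, stableSymbol, one_mul, mul_comm]
  obtain ⟨G', G'', C, hC, hG, hG', hG''⟩ :=
    exists_hasDerivAt_exp_neg_rpow (half_pos h0) (by linarith : α / 2 < 1) hc
  have key : ∀ h : ℝ, 0 < h → ∀ y : ℝ, 2 * h ≤ y →
      ‖stableSymbol α 1 (Complex.I * (y + h : ℝ)) - 2 * stableSymbol α 1 (Complex.I * y) +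
        stableSymbol α 1 (Complex.I * (y - h : ℝ))‖ ≤
        2 * (C * (1 / 2) ^ (α / 2 - 2)) * h ^ 2 * y ^ (α / 2 - 2) := fun h hh y hy => by
    rw [hg _ (by linarith), hg _ (by linarith), hg _ (by linarith)]
    have hpos : ∀ x ∈ Icc (y - h) (y + h), 0 < x := fun x hx => by linarith [hx.1]
    have := norm_second_difference_le (M := C * ((1 / 2) * y) ^ (α / 2 - 2)) hh.le
      (fun x hx => hG x (hpos x hx)) (fun x hx => hG' x (hpos x hx)) fun x hx => ?_
    · refine this.trans_eq ?_
      rw [Real.mul_rpow (by norm_num) (by linarith)]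
      ring
    · refine (hG'' x (hpos x hx)).trans ?_
      gcongr ?_ * ?_
      exact Real.rpow_le_rpow_of_nonpos (by linarith) (by linarith [hx.1]) (by linarith)
  refine ⟨2 * (C * (1 / 2) ^ (α / 2 - 2)), by positivity, fun h hh y hy => ?_⟩
  rcases le_total 0 y with hy0 | hy0
  · rw [abs_of_nonneg hy0] at hy ⊢
    exact key h hh y hy
  · rw [abs_of_nonpos hy0] at hy ⊢
    refine le_trans (le_of_eq ?_) (key h hh (-y) hy)
    rw [← RCLike.norm_conj]
    simp only [map_add, map_sub, map_mul, ← stableSymbol_I_mul_neg, map_ofNat]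
    rw [show -(y + h) = -y - h by ring, show -(y - h) = -y + h by ring]
    congr 1
    ring

lemma continuous_stableSymbol_I_mul {α t : ℝ} (h0 : 0 < α) :
    Continuous fun y : ℝ => stableSymbol α t (Complex.I * y) := by
  simpa [mul_comm Complex.I] using continuous_stableSymbol_line (t := t) h0 le_rfl

lemma integrable_stable_integrand {α t : ℝ} (h0 : 0 < α) (h2 : α < 2) (ht : 0 < t) (u : ℝ) :
    Integrable fun y : ℝ =>
      Complex.exp ((Complex.I * y) * u) * stableSymbol α t (Complex.I * y) := by
  simpa [mul_comm Complex.I] using integrable_stable_line h0 h2 ht le_rfl u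

/-- The Fourier integral of `g`, expressed through its second difference with step `π / u`. -/
lemma stable_integral_eq_second_difference {α : ℝ} (h0 : 0 < α) (h2 : α < 2) {u h : ℝ}
    (hu : h * u = Real.pi) :
    ∫ y : ℝ, Complex.exp ((Complex.I * y) * u) *
      (stableSymbol α 1 (Complex.I * (y + h : ℝ)) - 2 * stableSymbol α 1 (Complex.I * y) +
        stableSymbol α 1 (Complex.I * (y - h : ℝ))) =
    -4 * ∫ y : ℝ, Complex.exp ((Complex.I * y) * u) * stableSymbol α 1 (Complex.I * y) := by
  set f : ℝ → ℂ := fun y =>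
    Complex.exp ((Complex.I * y) * u) * stableSymbol α 1 (Complex.I * y) with hf
  have hfi : Integrable f := integrable_stable_integrand h0 h2 one_pos u
  have huc : (h : ℂ) * u = Real.pi := by exact_mod_cast hu
  -- Since `h u = π`, a shift by `±h` flips the sign of the exponential. Each outer term therefore
  -- integrates to minus the original integral, and the middle one gives `-2` times it.
  have e1 : ∀ y : ℝ, Complex.exp ((Complex.I * y) * u) *
      stableSymbol α 1 (Complex.I * (y + h : ℝ)) = -f (y + h) := fun y => by
    have : Complex.exp ((Complex.I * (y + h : ℝ)) * u) = -Complex.exp ((Complex.I * y) * u) := by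
      rw [show (Complex.I * (y + h : ℝ)) * u = (Complex.I * y) * u + Real.pi * Complex.I by
        rw [← huc]; push_cast; ring, Complex.exp_add, Complex.exp_pi_mul_I, mul_neg_one]
    rw [hf]
    simp only [this, neg_mul, neg_neg]
  have e2 : ∀ y : ℝ, Complex.exp ((Complex.I * y) * u) *
      stableSymbol α 1 (Complex.I * (y - h : ℝ)) = -f (y - h) := fun y => by
    have : Complex.exp ((Complex.I * (y - h : ℝ)) * u) = -Complex.exp ((Complex.I * y) * u) := by
      rw [show (Complex.I * (y - h : ℝ)) * u = (Complex.I * y) * u - Real.pi * Complex.I by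
        rw [← huc]; push_cast; ring, Complex.exp_sub, Complex.exp_pi_mul_I, div_neg, div_one]
    rw [hf]
    simp only [this, neg_mul, neg_neg]
  have e : ∀ y : ℝ, Complex.exp ((Complex.I * y) * u) *
      (stableSymbol α 1 (Complex.I * (y + h : ℝ)) - 2 * stableSymbol α 1 (Complex.I * y) +
        stableSymbol α 1 (Complex.I * (y - h : ℝ))) = -f (y + h) - 2 * f y + -f (y - h) :=
    fun y => by rw [← e1, ← e2]; ring
  simp only [e]
  rw [integral_add, integral_sub, integral_neg, integral_neg, integral_const_mul,
    integral_add_right_eq_self f, integral_sub_right_eq_self f]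
  · ring
  · exact (hfi.comp_add_right h).neg
  · exact hfi.const_mul 2
  · exact (hfi.comp_add_right h).neg.sub (hfi.const_mul 2)
  · exact (hfi.comp_sub_right h).neg

/-- The stable density decays like `u ^ (-1 - α / 2)`. -/
lemma exists_norm_stable_integral_le_rpow {α : ℝ} (h0 : 0 < α) (h2 : α < 2) :
    ∃ K : ℝ, ∀ u : ℝ, 0 < u →
      ‖∫ y : ℝ, Complex.exp ((Complex.I * y) * u) * stableSymbol α 1 (Complex.I * y)‖ ≤
        K * u ^ (-1 - α / 2) := by
  obtain ⟨C, hC, hfar⟩ := exists_norm_second_difference_stableSymbol_le h0 h2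
  set a := α / 2 with ha
  have ha0 : 0 < a := half_pos h0
  have ha1 : a < 1 := by rw [ha]; linarith
  -- The weights `1, -2, 1` sum to zero, so `1` may be subtracted from each value of the symbol. The
  -- stencil lies in `|x| ≤ 3h`, and total weight `4` times `2 (3h)^a` gives the bound.
  have hnear : ∀ h : ℝ, 0 < h → ∀ y : ℝ, |y| ≤ 2 * h →
      ‖stableSymbol α 1 (Complex.I * (y + h : ℝ)) - 2 * stableSymbol α 1 (Complex.I * y) +
        stableSymbol α 1 (Complex.I * (y - h : ℝ))‖ ≤ 8 * (3 * h) ^ a := fun h hh y hy => by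
    have hb : ∀ x : ℝ, |x| ≤ 3 * h → ‖stableSymbol α 1 (Complex.I * x) - 1‖ ≤ 2 * (3 * h) ^ a :=
      fun x hx => by
        refine (norm_stableSymbol_sub_one_le h0 h2 (by simp)).trans ?_
        rw [norm_mul, Complex.norm_I, one_mul, Complex.norm_real, Real.norm_eq_abs]
        gcongr
    have h1 := hb (y + h) (by rw [abs_le] at hy ⊢; constructor <;> linarith)
    have h2 := hb y (by linarith)
    have h3 := hb (y - h) (by rw [abs_le] at hy ⊢; constructor <;> linarith)
    calc _ = ‖(stableSymbol α 1 (Complex.I * (y + h : ℝ)) - 1) -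
          2 * (stableSymbol α 1 (Complex.I * y) - 1) +
          (stableSymbol α 1 (Complex.I * (y - h : ℝ)) - 1)‖ := by congr 1; ring
      _ ≤ _ := norm_add_le _ _
      _ ≤ _ := add_le_add_left (norm_sub_le _ _) _
      _ ≤ _ := by rw [norm_mul, RCLike.norm_ofNat]; linarith
  refine ⟨(16 * 3 ^ a + C * (2 ^ (a - 1) / (1 - a))) / 2 * Real.pi ^ (1 + a), fun u hu => ?_⟩
  set h := Real.pi / u with hh
  have hh0 : 0 < h := div_pos Real.pi_pos hu
  have hhu : h * u = Real.pi := div_mul_cancel₀ _ hu.ne'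
  -- Both pieces integrate to a multiple of `h^(1+a)`, that is, of `u^(-1-a)`. A first difference
  -- would leave the tail bound `h y^(a-1)`, not integrable at infinity; the second yields `h²
  -- y^(a-2)`, which is.
  set B : ℝ → ℝ := fun y => if y ≤ 2 * h then 8 * (3 * h) ^ a else C * h ^ 2 * y ^ (a - 2) with hB
  have hB1 : IntegrableOn B (Ioc 0 (2 * h)) :=
    (integrableOn_const (C := 8 * (3 * h) ^ a) measure_Ioc_lt_top.ne).congr_fun
      (fun y hy => by simp only [hB, if_pos hy.2]) measurableSet_Ioc
  have hB2 : IntegrableOn B (Ioi (2 * h)) :=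
    IntegrableOn.congr_fun ((integrableOn_Ioi_rpow_of_lt (by linarith : a - 2 < -1)
      (by linarith : 0 < 2 * h)).const_mul (C * h ^ 2))
      (fun y hy => by simp only [hB, if_neg (not_le.2 (mem_Ioi.1 hy))]) measurableSet_Ioi
  have hunion : Ioc 0 (2 * h) ∪ Ioi (2 * h) = Ioi 0 := Ioc_union_Ioi_eq_Ioi (by linarith)
  have hBi : IntegrableOn B (Ioi 0) := hunion ▸ hB1.union hB2
  have hBint : ∫ y in Ioi (0 : ℝ), B y =
      16 * h * (3 * h) ^ a + C * h ^ 2 * ((2 * h) ^ (a - 1) / (1 - a)) := by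
    rw [← hunion, setIntegral_union (by
      rw [disjoint_left]; exact fun x hx hx' => not_lt.2 hx.2 hx') measurableSet_Ioi hB1 hB2]
    congr 1
    · rw [setIntegral_congr_fun (g := fun _ => 8 * (3 * h) ^ a) measurableSet_Ioc
        fun y hy => by simp only [hB, if_pos hy.2]]
      rw [setIntegral_const, Real.volume_real_Ioc_of_le (by linarith), smul_eq_mul]
      ring
    · rw [setIntegral_congr_fun (g := fun y => C * h ^ 2 * y ^ (a - 2)) measurableSet_Ioi
        fun y hy => by simp only [hB, if_neg (not_le.2 (mem_Ioi.1 hy))]]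
      rw [integral_const_mul, integral_Ioi_rpow_of_lt (by linarith) (by linarith),
        show a - 2 + 1 = a - 1 by ring, ← neg_sub 1 a, neg_div_neg_eq]
  have hBabs : Integrable fun y : ℝ => B |y| := by
    have h1 : IntegrableOn (fun y : ℝ => B |y|) (Ioi 0) :=
      hBi.congr_fun (fun y hy => by simp only [abs_of_pos (mem_Ioi.1 hy)]) measurableSet_Ioi
    have h2 : IntegrableOn (fun y : ℝ => B |y|) (Iio 0) := by
      have := h1.comp_neg
      simpa using this
    have h3 := (h2.union (integrableOn_singleton (x := (0:ℝ)) (by simp) (by simp))).union h1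
    rw [Iio_union_right, Iic_union_Ioi] at h3
    exact integrableOn_univ.1 h3
  have hF := stable_integral_eq_second_difference h0 h2 hhu
  have hle := norm_integral_le_of_norm_le (f := fun y : ℝ => Complex.exp ((Complex.I * y) * u) *
      (stableSymbol α 1 (Complex.I * (y + h : ℝ)) - 2 * stableSymbol α 1 (Complex.I * y) +
        stableSymbol α 1 (Complex.I * (y - h : ℝ)))) hBabs (ae_of_all _ fun y => ?_)
  · rw [hF, norm_mul, norm_neg, RCLike.norm_ofNat, integral_comp_abs, hBint] at hle
    have e1 : h * (3 * h) ^ a = 3 ^ a * h ^ (1 + a) := by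
      rw [Real.mul_rpow (by norm_num) hh0.le, Real.rpow_add hh0, Real.rpow_one]; ring
    have e2 : h ^ 2 * (2 * h) ^ (a - 1) = 2 ^ (a - 1) * h ^ (1 + a) := by
      rw [Real.mul_rpow (by norm_num) hh0.le, show 1 + a = 2 + (a - 1) by ring, Real.rpow_add hh0,
        Real.rpow_two]; ring
    have e3 : h ^ (1 + a) = Real.pi ^ (1 + a) * u ^ (-1 - a) := by
      rw [hh, Real.div_rpow Real.pi_pos.le hu.le, show -1 - a = -(1 + a) by ring,
        Real.rpow_neg hu.le, div_eq_mul_inv]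
    have e4 : 2 * (16 * h * (3 * h) ^ a + C * h ^ 2 * ((2 * h) ^ (a - 1) / (1 - a))) =
        2 * (16 * 3 ^ a + C * (2 ^ (a - 1) / (1 - a))) * (Real.pi ^ (1 + a) * u ^ (-1 - a)) := by
      rw [← e3]
      linear_combination 32 * e1 + 2 * C / (1 - a) * e2
    rw [e4] at hle
    linarith
  · rw [norm_mul, Complex.norm_exp]
    simp only [Complex.mul_re, Complex.I_re, Complex.ofReal_re, Complex.I_im, Complex.ofReal_im,
      zero_mul, mul_zero, sub_zero, Complex.mul_im, one_mul, zero_add, Real.exp_zero, hB]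
    split_ifs with hy
    · exact hnear h hh0 y hy
    · exact hfar h hh0 y (not_le.1 hy).le

lemma continuous_stableDensity {α t : ℝ} (h0 : 0 < α) (h2 : α < 2) (ht : 0 < t) :
    Continuous (stableDensity α t) :=
  continuous_const.mul (Complex.continuous_re.comp (continuous_stable_integral h0 h2 ht))

/-- Continuity handles `(0, 1]`, and the power decay handles `(1, ∞)` because `α > 0`. -/
lemma integrableOn_stableDensity {α : ℝ} (h0 : 0 < α) (h2 : α < 2) :
    IntegrableOn (stableDensity α 1) (Ioi 0) := by
  have hcont := continuous_stableDensity h0 h2 one_pos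
  obtain ⟨K, hK⟩ := exists_norm_stable_integral_le_rpow h0 h2
  rw [← Ioc_union_Ioi_eq_Ioi (zero_le_one' ℝ)]
  refine (hcont.integrableOn_Icc.mono_set Ioc_subset_Icc_self).union ?_
  refine Integrable.mono' (g := fun u => (2 * Real.pi)⁻¹ * (K * u ^ (-1 - α / 2)))
    (((integrableOn_Ioi_rpow_of_lt (by linarith) one_pos).const_mul K).const_mul _)
    hcont.aestronglyMeasurable ?_
  filter_upwards [ae_restrict_mem measurableSet_Ioi] with u hu
  rw [stableDensity, norm_mul, Real.norm_of_nonneg (by positivity)]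
  gcongr
  exact (Complex.abs_re_le_norm _).trans (hK u (one_pos.trans hu))

end StableDensity

/-! ### From heat kernel bounds to the stable kernel. -/

section StableKernel

variable {V : Type*} (G : SimpleGraph V) [G.LocallyFinite] (q : ℕ)
    (hG : G.IsRegularOfDegree (q + 1))

lemma stableKernel_eq (o : V) {α t : ℝ} (h0 : 0 < α) (ht : 0 < t) (x : V) :
    stableKernel G q hG o α t x =
      ∫ s in Ioi (0 : ℝ), heatKernel G q hG o (t ^ (2 / α) * s) x * stableDensity α 1 s := by
  have hr : 0 < t ^ (2 / α) := Real.rpow_pos_of_pos ht _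
  have h := integral_comp_mul_left_Ioi
    (fun u => heatKernel G q hG o u x * stableDensity α t u) 0 hr
  simp only [stableDensity_mul h0 ht, mul_zero, smul_eq_mul,
    mul_left_comm _ (t ^ (2 / α))⁻¹] at h
  rw [integral_const_mul] at h
  exact (mul_left_cancel₀ (inv_pos.2 hr).ne' h).symm

/-- After rescaling, `t` enters only through the heat kernel's time, so the weight `|η_1|` is the
same for all `t`. -/
lemma norm_sum_stableKernel_le (o : V) {α t : ℝ} (h0 : 0 < α) (h2 : α < 2) (ht : 0 < t)
    (s : Finset V) {Φ : ℝ → ℝ} (hΦ : Continuous Φ) (hΦ1 : ∀ u, ‖Φ u‖ ≤ 1)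
    (hs : ∀ u, 0 ≤ u → ∑ x ∈ s, heatKernel G q hG o u x ≤ Φ u) :
    ‖∑ x ∈ s, stableKernel G q hG o α t x‖ ≤
      ∫ v in Ioi (0 : ℝ), Φ (t ^ (2 / α) * v) * ‖stableDensity α 1 v‖ := by
  have hr : 0 ≤ t ^ (2 / α) := Real.rpow_nonneg ht.le _
  have hη := integrableOn_stableDensity h0 h2
  have hint : ∀ x ∈ s, IntegrableOn
      (fun v => heatKernel G q hG o (t ^ (2 / α) * v) x * stableDensity α 1 v) (Ioi 0) :=
    fun x _ => by
      refine Integrable.bdd_mul (c := 1) hη ?_ ?_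
      · exact ((continuous_heatKernel G q hG o x).comp (by fun_prop)).aestronglyMeasurable
      · filter_upwards [ae_restrict_mem measurableSet_Ioi] with v hv
        have hu : 0 ≤ t ^ (2 / α) * v := mul_nonneg hr (mem_Ioi.1 hv).le
        rw [Real.norm_of_nonneg (heatKernel_nonneg G q hG o hu x)]
        simpa using sum_heatKernel_le_one G q hG o hu {x}
  simp only [stableKernel_eq G q hG o h0 ht]
  rw [← integral_finsetSum s hint]
  apply norm_integral_le_of_norm_le
  · exact Integrable.bdd_mul hη.norm (hΦ.comp (by fun_prop)).aestronglyMeasurable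
      (ae_of_all _ fun v => hΦ1 _)
  · filter_upwards [ae_restrict_mem measurableSet_Ioi] with v hv
    have hu : 0 ≤ t ^ (2 / α) * v := mul_nonneg hr (mem_Ioi.1 hv).le
    rw [← Finset.sum_mul, norm_mul, Real.norm_of_nonneg
      (Finset.sum_nonneg fun x _ => heatKernel_nonneg G q hG o hu x)]
    gcongr
    exact hs _ hu

lemma norm_tsum_le_of_norm_sum_le {ι : Type*} {f : ι → ℝ} {C : ℝ}
    (h : ∀ s : Finset ι, ‖∑ i ∈ s, f i‖ ≤ C) : ‖∑' i, f i‖ ≤ C := by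
  by_cases hf : Summable f
  · exact le_of_tendsto' hf.hasSum.norm h
  · rw [tsum_eq_zero_of_not_summable hf]
    simpa using h ∅

/-- If the heat kernel at time `u` gives `S t` mass at most `exp (E t u)`, and this exponent tends
to `-∞` at the stable scale `u ≍ t ^ (2 / α)`, then the stable kernel at time `t` gives `S t`
vanishing mass. -/
lemma tendsto_tsum_stableKernel (o : V) {α : ℝ} (h0 : 0 < α) (h2 : α < 2) (S : ℝ → V → Prop)
    (E : ℝ → ℝ → ℝ) (hE : ∀ t, Continuous (E t))
    (hS : ∀ t, ∀ s : Finset V, (∀ x ∈ s, S t x) → ∀ u, 0 ≤ u →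
      ∑ x ∈ s, heatKernel G q hG o u x ≤ Real.exp (E t u))
    (hlim : ∀ v, 0 < v → Tendsto (fun t => E t (t ^ (2 / α) * v)) atTop atBot) :
    Tendsto (fun t : ℝ => ∑' x : {x : V // S t x}, stableKernel G q hG o α t x) atTop (𝓝 0) := by
  -- The exponential bound can be huge for large `u`; capping it by the total mass `1` makes `|η_1|`
  -- a majorant for all `t`.
  set Φ : ℝ → ℝ → ℝ := fun t u => min 1 (Real.exp (E t u))
  have hΦ0 : ∀ t u, 0 ≤ Φ t u := fun t u => le_min zero_le_one (Real.exp_pos _).le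
  have hΦ1 : ∀ t u, ‖Φ t u‖ ≤ 1 := fun t u => by
    rw [Real.norm_of_nonneg (hΦ0 t u)]
    exact min_le_left _ _
  have hΦc : ∀ t, Continuous (Φ t) := fun t => by
    have := hE t
    fun_prop
  have hdom : Tendsto (fun t : ℝ => ∫ v in Ioi (0 : ℝ), Φ t (t ^ (2 / α) * v) *
      ‖stableDensity α 1 v‖) atTop (𝓝 (∫ _v in Ioi (0 : ℝ), 0)) := by
    refine tendsto_integral_filter_of_dominated_convergence (fun v => ‖stableDensity α 1 v‖)
      (Eventually.of_forall fun t => ?_) (Eventually.of_forall fun t => ae_of_all _ fun v => ?_)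
      (integrableOn_stableDensity h0 h2).norm ?_
    · exact (((hΦc t).comp (by fun_prop)).mul
        (continuous_stableDensity h0 h2 one_pos).norm).aestronglyMeasurable
    · rw [norm_mul, norm_norm]
      exact mul_le_of_le_one_left (norm_nonneg _) (hΦ1 _ _)
    · filter_upwards [ae_restrict_mem measurableSet_Ioi] with v hv
      have h1 := Real.tendsto_exp_atBot.comp (hlim v hv)
      have h3 : Tendsto (fun t => Φ t (t ^ (2 / α) * v)) atTop (𝓝 0) :=
        squeeze_zero (fun t => hΦ0 _ _) (fun t => min_le_right _ _) h1
      simpa using h3.mul_const ‖stableDensity α 1 v‖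
  rw [integral_zero] at hdom
  apply squeeze_zero_norm' _ hdom
  filter_upwards [eventually_gt_atTop 0] with t ht
  refine norm_tsum_le_of_norm_sum_le fun s => ?_
  have := norm_sum_stableKernel_le G q hG o h0 h2 ht (s.map (Function.Embedding.subtype _))
    (hΦc t) (hΦ1 t) fun u hu => le_min (sum_heatKernel_le_one G q hG o hu _)
      (hS t _ (fun x hx => by
        obtain ⟨y, -, rfl⟩ := Finset.mem_map.1 hx
        exact y.2) u hu)
  simpa using this

/-- Factor out `t^β`: the cofactor tends to `-c < 0`, whatever the sign of `d`. -/
lemma tendsto_mul_rpow_sub_mul_rpow_atBot {γ β c : ℝ} (d : ℝ) (hγβ : γ < β) (hβ : 0 < β)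
    (hc : 0 < c) : Tendsto (fun t : ℝ => d * t ^ γ - c * t ^ β) atTop atBot := by
  have h1 : Tendsto (fun t : ℝ => d * t ^ (-(β - γ)) - c) atTop (𝓝 (-c)) := by
    simpa using ((tendsto_rpow_neg_atTop (sub_pos.2 hγβ)).const_mul d).sub_const c
  refine ((tendsto_rpow_atTop hβ).atTop_mul_neg (neg_lt_zero.2 hc) h1).congr' ?_
  filter_upwards [eventually_gt_atTop 0] with t ht
  rw [show γ = β + -(β - γ) by ring, Real.rpow_add ht]
  ring_nf

end StableKernel

end HomogeneousTree

theorem mainTheorem8 {V : Type*} (G : SimpleGraph V) [G.LocallyFinite] (hT : G.IsTree)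
    (q : ℕ) (hq : 2 ≤ q) (hG : G.IsRegularOfDegree (q + 1)) (o : V)
    (α : ℝ) (hα0 : 0 < α) (hα2 : α < 2)
    (A₁ A₂ : ℝ) (hA₁ : 0 < A₁) (hA₂ : A₁ < A₂)
    (β : ℝ) (hβ : 0 < β) (hβα : β ≠ 2 / α) :
    Filter.Tendsto
      (fun t : ℝ =>
        ∑' x : {x : V // A₁ * t ^ β ≤ (G.dist o x : ℝ) ∧ (G.dist o x : ℝ) ≤ A₂ * t ^ β},
          HomogeneousTree.stableKernel G q hG o α t x)
      Filter.atTop (nhds 0) := by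
  -- If `β < 2/α` the walk has escaped beyond the outer radius, and `u/18` of order `t^(2/α)`
  -- dominates. If `β > 2/α` it has not reached the inner radius, and the `t^β` term dominates.
  rcases lt_or_gt_of_ne hβα with h | h
  · refine HomogeneousTree.tendsto_tsum_stableKernel G q hG o hα0 hα2 _
      (fun t u => Real.log (3 / 2) * (A₂ * t ^ β) - u / 18) (fun t => by fun_prop)
      (fun t s hs u hu => HomogeneousTree.sum_heatKernel_near_le G q hG hT hq o hu s
        fun x hx => (hs x hx).2) fun v hv => ?_
    refine (HomogeneousTree.tendsto_mul_rpow_sub_mul_rpow_atBot (Real.log (3 / 2) * A₂) h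
      (by positivity) (by positivity : 0 < v / 18)).congr fun t => ?_
    ring
  · refine HomogeneousTree.tendsto_tsum_stableKernel G q hG o hα0 hα2 _
      (fun t u => u - Real.log 2 * (A₁ * t ^ β)) (fun t => by fun_prop)
      (fun t s hs u hu => HomogeneousTree.sum_heatKernel_far_le G q hG hT o hu s
        fun x hx => (hs x hx).1) fun v hv => ?_
    refine (HomogeneousTree.tendsto_mul_rpow_sub_mul_rpow_atBot v h
      hβ (mul_pos (Real.log_pos one_lt_two) hA₁)).congr fun t => ?_
    ring
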